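/- Let $\Theta$ be a finite set, let $\pi$ be a probability distribution on $\Theta$ with full support, and let $A$ be a non-empty finite subset of $\mathbb{R}^\Theta$ (actions, identified with their utility profiles). Write $\mathbf 1=(1,\dots,1)$, and $\Delta(A)$ for the set of probability distributions on $A$. Let $f\colon\mathbb{R}_+^\Theta\to[0,+\infty]$ be convex and lower semicontinuous with $f(\mathbf 1)=0$, let $\operatorname{dom} f=\{x: f(x)<+\infty\}$, and suppose that * $f$ is co-finite: $\lim_{t\to+\infty} f(y+tx)/t=+\infty$ for all $y\in\operatorname{dom} f$ and all non-zero $x\in\mathbb{R}_+^\Theta$; * $f$ is essentially strictly convex: $f$ is strictly convex on every convex subset of $\{x\in\mathbb{R}^\Theta_+:\partial f(x)\neq\varnothing\}$; * $\mathbf 1$ lies in the relative interior of $\operatorname{dom} f$. For $P=(P_\theta)_{\theta\in\Theta}\in\Delta(A)^\Theta$ (a stochastic choice rule) and $\alpha\in\Delta(A)$ let $$D_f(P\Vert\alpha)=\sum_{a\in A}\alpha(a)\,f\!\left(\left(\frac{P_\theta(a)}{\alpha(a)}\right)_{\theta\in\Theta}\right),\qquad I_f(P)=\inf_{\alpha\in\Delta(A)}D_f(P\Vert\alpha),$$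 with the convention $0f(x/0)=\lim_{t\to+\infty}f(y+tx)/t$ for any $y\in\operatorname{dom} f$. Call $\alpha\in\Delta(A)$ an $f$-mean of $P$ if $I_f(P)=D_f(P\Vert\alpha)$. Let $f^\star(x)=\sup_{y\in\mathbb{R}^\Theta_+}\sum_\theta x(\theta)y(\theta)-f(y)$ be the Fenchel conjugate of $f$, and let $a\pi=(a(\theta)\pi(\theta))_{\theta\in\Theta}$. Consider the problems $$\text{(1)}\quad \max_{P\in\Delta(A)^\Theta}\ \sum_{\theta}\pi(\theta)\sum_{a\in A}P_\theta(a)a(\theta)-I_f(P),$$ $$\text{(2)}\quad \max_{\alpha\in\Delta(A)}\min_{\lambda\in\mathbb{R}^\Theta}\ \sum_{a\in A}\alpha(a)f^\star(a\pi-\lambda)+\sum_{\theta}\lambda(\theta).$$ Then $f^\star$ is finite and differentiable on $\mathbb{R}^\Theta$, and: (i) A stochastic choice rule $P$ is a solution of (1) if and only if there is a saddle point $(\alpha,\lambda)\in\Delta(A)\times\mathbb{R}^\Theta$ of (2) such that $P_\theta(a)=\alpha(a)\nabla_\theta f^\star(a\pi-\lambda)$ for all $\theta\in\Theta$ and $a\in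 A$. Moreover, for any such $P$ and $(\alpha,\lambda)$, $\alpha$ is an $f$-mean of $P$. (ii) The problems (1) and (2) have the same value; this value is finite, and both maxima are attained (the value of the inner problem in (2) being the infimum over $\lambda$). -/

import Mathlib

open Filter Topology
open scoped NNReal ENNReal

noncomputable section

namespace FInfo

/-! A function `f` on the non-negative orthant of `ℝ^Θ` with values in `[0, +∞]` is represented by a
function `(Θ → ℝ) → ℝ≥0∞` of which only the values on `Set.Ici 0 = {x | 0 ≤ x}` are ever used. -/

variable {Θ Ω : Type*} [Fintype Θ] [Fintype Ω]

/-- The effective domain of `f`: the points of the non-negative orthant where `f` is finite. -/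
def dom (f : (Θ → ℝ) → ℝ≥0∞) : Set (Θ → ℝ) := {x | 0 ≤ x ∧ f x < ⊤}

/-- `f` generates an `f`-divergence: on the non-negative orthant it is convex and lower
semicontinuous, and `f 1 = 0`. (Non-negativity of `f` is in its type.) -/
structure IsGenerator (f : (Θ → ℝ) → ℝ≥0∞) : Prop where
  convex : ConvexOn ℝ≥0 (Set.Ici 0) f
  lsc : LowerSemicontinuousOn f (Set.Ici 0)
  one : f 1 = 0

/-- The recession function `x ↦ lim_{t → +∞} f (y + t x) / t`. The limit is the same for every
`y ∈ dom f`; it is taken at `y = 1`, which belongs to `dom f` because `f 1 = 0`. -/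
def recession (f : (Θ → ℝ) → ℝ≥0∞) (x : Θ → ℝ) : ℝ≥0∞ :=
  limUnder atTop (fun t : ℝ => f (1 + t • x) / ENNReal.ofReal t)

/-- The term `r f (x / r)`, with the convention that `0 f (x / 0)` is the recession function. -/
def persp (f : (Θ → ℝ) → ℝ≥0∞) (r : ℝ) (x : Θ → ℝ) : ℝ≥0∞ :=
  open Classical in
  if r = 0 then recession f x else ENNReal.ofReal r * f (fun θ => x θ / r)

/-- The multivariate `f`-divergence `D_f(P ‖ α)`. -/
def divergence (f : (Θ → ℝ) → ℝ≥0∞) (P : Θ → Ω → ℝ) (α : Ω → ℝ) : ℝ≥0∞ :=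
  ∑ ω, persp f (α ω) (fun θ => P θ ω)

/-- The `f`-information `I_f(P)`, the infimum of `D_f(P ‖ α)` over distributions `α`. -/
def info (f : (Θ → ℝ) → ℝ≥0∞) (P : Θ → Ω → ℝ) : ℝ≥0∞ :=
  ⨅ α ∈ stdSimplex ℝ Ω, divergence f P α

/-- `α` is an `f`-mean of `P`. -/
def IsFMean (f : (Θ → ℝ) → ℝ≥0∞) (P : Θ → Ω → ℝ) (α : Ω → ℝ) : Prop :=
  α ∈ stdSimplex ℝ Ω ∧ info f P = divergence f P α

/-- The subdifferential of `f` at `x`. -/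
def subdiff (f : (Θ → ℝ) → ℝ≥0∞) (x : Θ → ℝ) : Set (Θ → ℝ) :=
  {v | ∀ y : Θ → ℝ, 0 ≤ y →
    ((f x : ℝ≥0∞) : EReal) + ((∑ θ, v θ * (y θ - x θ) : ℝ) : EReal) ≤ ((f y : ℝ≥0∞) : EReal)}

/-- `f` is co-finite: `f (y + t x) / t → +∞` for `y ∈ dom f` and non-zero `x ≥ 0`. -/
def IsCofinite (f : (Θ → ℝ) → ℝ≥0∞) : Prop :=
  ∀ y ∈ dom f, ∀ x : Θ → ℝ, 0 ≤ x → x ≠ 0 →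
    Tendsto (fun t : ℝ => f (y + t • x) / ENNReal.ofReal t) atTop (𝓝 ⊤)

/-- `f` is essentially strictly convex: strictly convex on every convex subset of the set of
points `x ≥ 0` at which the subdifferential is non-empty. -/
def IsEssStrictConvex (f : (Θ → ℝ) → ℝ≥0∞) : Prop :=
  ∀ s : Set (Θ → ℝ), s ⊆ {x | 0 ≤ x ∧ (subdiff f x).Nonempty} → Convex ℝ s →
    StrictConvexOn ℝ≥0 s f

/-- The standing regularity assumption on `f`. -/
structure IsRegular (f : (Θ → ℝ) → ℝ≥0∞) : Prop where
  cofinite : IsCofinite f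
  essStrictConvex : IsEssStrictConvex f
  one_mem_ri : (1 : Θ → ℝ) ∈ intrinsicInterior ℝ (dom f)

/-- The Fenchel conjugate `f⋆ (x) = sup_{y ≥ 0} ∑_θ x(θ) y(θ) - f(y)`. -/
def conj (f : (Θ → ℝ) → ℝ≥0∞) (x : Θ → ℝ) : EReal :=
  ⨆ y ∈ Set.Ici (0 : Θ → ℝ), (((∑ θ, x θ * y θ : ℝ) : EReal) - ((f y : ℝ≥0∞) : EReal))

/-- The partial derivative `∇_θ f⋆ (x)`. -/
def gradConj [DecidableEq Θ] (f : (Θ → ℝ) → ℝ≥0∞) (x : Θ → ℝ) (θ : Θ) : ℝ :=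
  fderiv ℝ (fun z => (conj f z).toReal) x (Pi.single θ 1)

/-! Decision problems: an action is a utility profile `a : Θ → ℝ`, and `A` is a finite set of
actions. -/

/-- `P` is a stochastic choice rule on `A`. -/
def IsChoiceRule {A : Finset (Θ → ℝ)} (P : Θ → A → ℝ) : Prop := ∀ θ, P θ ∈ stdSimplex ℝ A

/-- The net payoff `∑_θ π(θ) ∑_a P_θ(a) a(θ) - I_f(P)` of a choice rule. -/
def payoff (f : (Θ → ℝ) → ℝ≥0∞) (π : Θ → ℝ) {A : Finset (Θ → ℝ)} (P : Θ → A → ℝ) : EReal :=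
  ((∑ θ, π θ * ∑ a : A, P θ a * (a : Θ → ℝ) θ : ℝ) : EReal) - ((info f P : ℝ≥0∞) : EReal)

/-- `P` solves the information acquisition problem. -/
def IsSolution (f : (Θ → ℝ) → ℝ≥0∞) (π : Θ → ℝ) {A : Finset (Θ → ℝ)} (P : Θ → A → ℝ) : Prop :=
  IsChoiceRule P ∧ ∀ Q : Θ → A → ℝ, IsChoiceRule Q → payoff f π Q ≤ payoff f π P

/-- The vector `aπ - λ`. -/
def shifted (π : Θ → ℝ) (l : Θ → ℝ) (a : Θ → ℝ) : Θ → ℝ := fun θ => a θ * π θ - l θ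

/-- The objective `∑_a α(a) f⋆(aπ - λ) + ∑_θ λ(θ)` of the maxmin problem. -/
def dualObj (f : (Θ → ℝ) → ℝ≥0∞) (π : Θ → ℝ) {A : Finset (Θ → ℝ)} (α : A → ℝ) (l : Θ → ℝ) :
    EReal :=
  (∑ a : A, (α a : EReal) * conj f (shifted π l a)) + ((∑ θ, l θ : ℝ) : EReal)

/-- `(α, λ)` is a saddle point of the maxmin problem. -/
def IsSaddle (f : (Θ → ℝ) → ℝ≥0∞) (π : Θ → ℝ) {A : Finset (Θ → ℝ)} (α : A → ℝ) (l : Θ → ℝ) :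
    Prop :=
  α ∈ stdSimplex ℝ A ∧
    (∀ β ∈ stdSimplex ℝ A, dualObj f π β l ≤ dualObj f π α l) ∧
    (∀ m : Θ → ℝ, dualObj f π α l ≤ dualObj f π α m)

end FInfo

end

/-! Since `info` is an infimum over `α`, problem (1) is the joint maximization of `gain` minus
`divergence` over pairs `(P, α)` in a compact set. Co-finiteness makes the recession function `⊤`
off `0`, so the divergence is jointly lower semicontinuous and a joint optimum exists
(`exists_isJointOpt`).

Finite divergence means `P θ ω = α ω * y ω θ` with `y ω ∈ dom f`. The net gain is then `∑ α ω * (u ω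
⬝ᵥ y ω - f (y ω))`, under the constraint `∑ α ω • y ω = 1`. Dualizing this constraint with a
multiplier `l` and maximizing each term over `y ω` produces `f⋆ (u ω - l)`. Weak duality is
Fenchel–Young (`net_gain_le_realDual`). Strong duality holds because the value function of the
perturbed constraint `∑ α ω • y ω = z` is concave and, by the relative interior assumption, has a
supergradient at `z = 1` (`IsJointOpt.exists_multiplier`).

With no duality gap, Fenchel–Young is tight wherever `α ω ≠ 0`, so `y ω` attains `f⋆ (u ω - l)`.
Essential strict convexity makes that maximizer unique, hence equal to the gradient of `f⋆`
(`IsConjMax.hasFDerivAt`). Conversely, the gradient formula makes Fenchel–Young tight, so a saddle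
point gives a joint optimum. -/

noncomputable section

namespace FInfo

/-! ### Two general tools: attainment on compacta and existence of supergradients. -/

/-- A lower semicontinuous cost and a continuous benefit: net benefit is maximized on compacta. -/
lemma exists_max_sub {X : Type*} [TopologicalSpace X] {K : Set X} (hK : IsCompact K)
    (hne : K.Nonempty) {F : X → ℝ≥0∞} (hF : LowerSemicontinuousOn F K) {u : X → ℝ}
    (hu : ContinuousOn u K) :
    ∃ x ∈ K, ∀ y ∈ K, F y ≠ ⊤ → F x ≠ ⊤ ∧ u y - (F y).toReal ≤ u x - (F x).toReal := by
  obtain ⟨B, hB⟩ := (hK.image_of_continuousOn hu).bddAbove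
  have hB' : ∀ z ∈ K, 0 ≤ B - u z := fun z hz => sub_nonneg.2 (hB ⟨z, hz, rfl⟩)
  -- Replacing `-u` by `B - u ≥ 0` turns the problem into minimizing a sum in `ℝ≥0∞`, with no
  -- subtraction of `⊤`.
  have hG : LowerSemicontinuousOn (fun z => F z + ENNReal.ofReal (B - u z)) K :=
    hF.add (ENNReal.continuous_ofReal.comp_continuousOn
      (continuousOn_const.sub hu)).lowerSemicontinuousOn
  obtain ⟨x, hx, hmin⟩ := hG.exists_isMinOn hne hK
  refine ⟨x, hx, fun y hy hFy => ?_⟩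
  have h : F x + ENNReal.ofReal (B - u x) ≤ F y + ENNReal.ofReal (B - u y) := hmin hy
  have htop : F y + ENNReal.ofReal (B - u y) ≠ ⊤ := by simp [hFy]
  have hFx : F x ≠ ⊤ := fun h' => by simp [h', hFy] at h
  refine ⟨hFx, ?_⟩
  have h2 := ENNReal.toReal_mono htop h
  rw [ENNReal.toReal_add hFx ENNReal.ofReal_ne_top, ENNReal.toReal_add hFy ENNReal.ofReal_ne_top,
    ENNReal.toReal_ofReal (hB' x hx), ENNReal.toReal_ofReal (hB' y hy)] at h2
  linarith

/-- A concave function, given by a convex subset `C` of its hypograph, whose domain absorbs the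
directions of `W` at `x₀`, has a supergradient at `x₀` along `W`. -/
lemma exists_supergradient {E : Type*} [AddCommGroup E] [Module ℝ E] (W : Submodule ℝ E)
    {C : Set (E × ℝ)} (hC : Convex ℝ C) (x₀ : E) (V : ℝ) (hV : ∀ r, (x₀, r) ∈ C → r ≤ V)
    (hW : ∀ w ∈ W, ∃ t : ℝ, 0 < t ∧ ∃ r, (x₀ + t • w, r) ∈ C) :
    ∃ g : E →ₗ[ℝ] ℝ, ∀ w ∈ W, ∀ r, (x₀ + w, r) ∈ C → r ≤ V + g w := by
  -- Difference quotients of the negated function from level `V`; their infimum `p` is sublinear,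
  -- and Hahn–Banach puts a linear map below it.
  let S : W → Set ℝ := fun w => {s | ∃ t r : ℝ, 0 < t ∧ (x₀ + t • (w : E), r) ∈ C ∧ s = (V - r) / t}
  have hSne : ∀ w, (S w).Nonempty := fun w => by
    obtain ⟨t, ht, r, hr⟩ := hW w w.2
    exact ⟨_, t, r, ht, hr, rfl⟩
  have hadd : ∀ w w' : W, ∀ s ∈ S w, ∀ s' ∈ S w', s + s' ∈ S (w + w') := by
    rintro w w' _ ⟨t, r, ht, hr, rfl⟩ _ ⟨t', r', ht', hr', rfl⟩
    have hpos : 0 < t + t' := by positivity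
    -- With these weights the `w` and `w'` components of the convex combination get the same
    -- coefficient.
    refine ⟨t * t' / (t + t'), t' / (t + t') * r + t / (t + t') * r', by positivity, ?_, ?_⟩
    · have := hC hr hr' (a := t' / (t + t')) (b := t / (t + t')) (by positivity) (by positivity)
        (by field_simp; ring)
      convert this using 1
      ext
      · simp only [Prod.smul_mk, Prod.mk_add_mk, Submodule.coe_add]
        have h1 : x₀ = (t' / (t + t')) • x₀ + (t / (t + t')) • x₀ := by
          rw [← add_smul, ← add_div, add_comm t', div_self hpos.ne', one_smul]
        nth_rewrite 1 [h1]
        simp only [smul_add, smul_smul]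
        have h2 : t' / (t + t') * t = t * t' / (t + t') := by ring
        have h3 : t / (t + t') * t' = t * t' / (t + t') := by ring
        rw [h2, h3]
        abel
      · simp
    · field_simp
      ring
  have hzero : ∀ s ∈ S 0, 0 ≤ s := by
    rintro _ ⟨t, r, ht, hr, rfl⟩
    have : r ≤ V := hV r (by simpa using hr)
    exact div_nonneg (by linarith) ht.le
  have hbdd : ∀ w, BddBelow (S w) := fun w => by
    -- `W` also absorbs `-w`, and a quotient for `w` plus one for `-w` is a quotient for `0`, hence
    -- nonnegative.
    obtain ⟨s', hs'⟩ := hSne (-w)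
    refine ⟨-s', fun s hs => ?_⟩
    have h := hadd w (-w) s hs s' hs'
    rw [add_neg_cancel] at h
    linarith [hzero _ h]
  let p : W → ℝ := fun w => sInf (S w)
  have hsmul : ∀ c : ℝ, 0 < c → ∀ w, ∀ s ∈ S w, c * s ∈ S (c • w) := by
    rintro c hc w _ ⟨t, r, ht, hr, rfl⟩
    refine ⟨t / c, r, by positivity, ?_, by field_simp⟩
    rwa [Submodule.coe_smul, smul_smul, div_mul_cancel₀ _ hc.ne']
  have hle : ∀ c : ℝ, 0 < c → ∀ w, p (c • w) ≤ c * p w := by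
    intro c hc w
    rw [← div_le_iff₀' hc]
    refine le_csInf (hSne w) fun s hs => ?_
    rw [div_le_iff₀' hc]
    exact csInf_le (hbdd _) (hsmul c hc w s hs)
  have hhom : ∀ c : ℝ, 0 < c → ∀ w, p (c • w) = c * p w := by
    intro c hc w
    refine le_antisymm (hle c hc w) ?_
    have := hle c⁻¹ (inv_pos.2 hc) (c • w)
    rw [smul_smul, inv_mul_cancel₀ hc.ne', one_smul] at this
    rwa [← div_eq_inv_mul, le_div_iff₀' hc] at this
  have hsub : ∀ w w', p (w + w') ≤ p w + p w' := by
    intro w w'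
    rw [← sub_le_iff_le_add]
    refine le_csInf (hSne w) fun s hs => ?_
    rw [sub_le_iff_le_add, ← sub_le_iff_le_add']
    refine le_csInf (hSne w') fun s' hs' => ?_
    rw [sub_le_iff_le_add']
    exact csInf_le (hbdd _) (hadd w w' s hs s' hs')
  obtain ⟨g, -, hg⟩ := exists_extension_of_le_sublinear (⟨⊥, 0⟩ : W →ₗ.[ℝ] ℝ) p hhom hsub (by
    rintro ⟨x, hx⟩
    rw [Submodule.mem_bot] at hx
    subst hx
    exact le_csInf (hSne 0) hzero)
  obtain ⟨G, hG⟩ := g.exists_extend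
  refine ⟨-G, fun w hw r hr => ?_⟩
  have h1 : G w = g ⟨w, hw⟩ := by rw [← hG]; rfl
  have h2 : p ⟨w, hw⟩ ≤ (V - r) / 1 := csInf_le (hbdd _) ⟨1, r, one_pos, by simpa using hr, rfl⟩
  have h3 := hg ⟨w, hw⟩
  rw [LinearMap.neg_apply, h1]
  linarith

/-! ### Convexity in real terms, and superlinear growth from co-finiteness. -/

section Growth

section Generator

variable {Θ : Type*} {f : (Θ → ℝ) → ℝ≥0∞}

lemma IsGenerator.one_mem_dom (hf : IsGenerator f) : (1 : Θ → ℝ) ∈ dom f :=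
  ⟨zero_le_one, by simp [hf.one]⟩

lemma IsGenerator.apply_combo_le (hf : IsGenerator f) {x y : Θ → ℝ} (hx : 0 ≤ x) (hy : 0 ≤ y)
    {a b : ℝ} (ha : 0 ≤ a) (hb : 0 ≤ b) (hab : a + b = 1) :
    f (a • x + b • y) ≤ ENNReal.ofReal a * f x + ENNReal.ofReal b * f y := by
  have hab' : a.toNNReal + b.toNNReal = 1 := by
    rw [← Real.toNNReal_add ha hb, hab, Real.toNNReal_one]
  have h : f (a.toNNReal • x + b.toNNReal • y) ≤ a.toNNReal • f x + b.toNNReal • f y :=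
    hf.convex.2 hx hy zero_le zero_le hab'
  rw [NNReal.smul_def, NNReal.smul_def, Real.coe_toNNReal a ha, Real.coe_toNNReal b hb] at h
  exact h

lemma toReal_combo {x y : Θ → ℝ} (hx : x ∈ dom f) (hy : y ∈ dom f) {a b : ℝ} (ha : 0 ≤ a)
    (hb : 0 ≤ b) : (ENNReal.ofReal a * f x + ENNReal.ofReal b * f y).toReal =
      a * (f x).toReal + b * (f y).toReal := by
  rw [ENNReal.toReal_add (ENNReal.mul_ne_top ENNReal.ofReal_ne_top hx.2.ne)
    (ENNReal.mul_ne_top ENNReal.ofReal_ne_top hy.2.ne), ENNReal.toReal_mul, ENNReal.toReal_mul,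
    ENNReal.toReal_ofReal ha, ENNReal.toReal_ofReal hb]

lemma IsGenerator.combo_mem_dom (hf : IsGenerator f) {x y : Θ → ℝ} (hx : x ∈ dom f)
    (hy : y ∈ dom f) {a b : ℝ} (ha : 0 ≤ a) (hb : 0 ≤ b) (hab : a + b = 1) :
    a • x + b • y ∈ dom f ∧
      (f (a • x + b • y)).toReal ≤ a * (f x).toReal + b * (f y).toReal := by
  have h := hf.apply_combo_le hx.1 hy.1 ha hb hab
  have htop : ENNReal.ofReal a * f x + ENNReal.ofReal b * f y < ⊤ :=
    ENNReal.add_lt_top.2 ⟨ENNReal.mul_lt_top ENNReal.ofReal_lt_top hx.2,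
      ENNReal.mul_lt_top ENNReal.ofReal_lt_top hy.2⟩
  refine ⟨⟨add_nonneg (smul_nonneg ha hx.1) (smul_nonneg hb hy.1), h.trans_lt htop⟩, ?_⟩
  rw [← toReal_combo hx hy ha hb]
  exact ENNReal.toReal_mono htop.ne h

lemma recession_zero (hf : IsGenerator f) : recession f 0 = 0 := by
  simp only [recession, smul_zero, add_zero, hf.one, ENNReal.zero_div]
  exact tendsto_const_nhds.limUnder_eq

lemma recession_of_ne_zero (hf : IsGenerator f) (hc : IsCofinite f) {x : Θ → ℝ} (hx : 0 ≤ x)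
    (hx0 : x ≠ 0) : recession f x = ⊤ :=
  (hc 1 hf.one_mem_dom x hx hx0).limUnder_eq

end Generator

variable {Θ : Type*} [Fintype Θ] {f : (Θ → ℝ) → ℝ≥0∞}

/-- Co-finiteness is superlinear growth, uniformly over directions. -/
lemma exists_growth (hf : IsGenerator f) (hc : IsCofinite f) {M : ℝ} (hM : 0 < M) :
    ∃ c : ℝ, ∀ y : Θ → ℝ, 0 ≤ y → ENNReal.ofReal (M * ‖y‖ - c) ≤ f y := by
  by_contra! hcon
  -- Points violating the bound with `c = n` escape to infinity. Their directions cluster at some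
  -- `e`; convexity between `1` and `y n` and lower semicontinuity then give `f (1 + t • e) ≤ t *
  -- M`, against co-finiteness along `e`.
  choose y hy0 hy using fun n : ℕ => hcon n
  have hynorm : ∀ n : ℕ, (n : ℝ) < M * ‖y n‖ := fun n => by
    have := ENNReal.ofReal_pos.1 (zero_le.trans_lt (hy n))
    linarith
  have hypos : ∀ n, 0 < ‖y n‖ := fun n => by
    by_contra! h
    nlinarith [hynorm n, (Nat.cast_nonneg n : (0 : ℝ) ≤ n)]
  have hlim : Tendsto (fun n => ‖y n‖) atTop atTop := by
    refine tendsto_atTop_mono (fun n => (div_le_iff₀' hM).2 (hynorm n).le)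
      (tendsto_natCast_atTop_atTop.atTop_div_const hM)
  let d : ℕ → Θ → ℝ := fun n => ‖y n‖⁻¹ • y n
  have hd : ∀ n, d n ∈ Metric.sphere (0 : Θ → ℝ) 1 := fun n => by
    simp [d, norm_smul, (hypos n).ne']
  obtain ⟨e, he, φ, hφ, hφlim⟩ := (isCompact_sphere (0 : Θ → ℝ) 1).tendsto_subseq hd
  have he0 : 0 ≤ e := ge_of_tendsto' hφlim fun n =>
    smul_nonneg (inv_nonneg.2 (norm_nonneg _)) (hy0 _)
  have hene : e ≠ 0 := by
    rintro rfl
    simp at he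
  have hbound : ∀ t : ℝ, 0 < t → f (1 + t • e) ≤ ENNReal.ofReal (t * M) := by
    intro t ht
    by_contra! hlt
    have hlimz : Tendsto (fun n => (1 - t / ‖y (φ n)‖) • (1 : Θ → ℝ) + t • d (φ n)) atTop
        (𝓝 (1 + t • e)) := by
      have h1 : Tendsto (fun n => 1 - t / ‖y (φ n)‖) atTop (𝓝 (1 - 0)) :=
        tendsto_const_nhds.sub (tendsto_const_nhds.div_atTop (hlim.comp hφ.tendsto_atTop))
      have := (h1.smul_const (1 : Θ → ℝ)).add (hφlim.const_smul t)
      simpa using this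
    have hev : ∀ᶠ n in atTop, t ≤ ‖y (φ n)‖ :=
      (hlim.comp hφ.tendsto_atTop).eventually_ge_atTop t
    have hcoef : ∀ n, t ≤ ‖y (φ n)‖ → 0 ≤ 1 - t / ‖y (φ n)‖ := fun n hn => by
      rw [sub_nonneg, div_le_one (hypos _)]
      exact hn
    have hmem : ∀ᶠ n in atTop,
        (1 - t / ‖y (φ n)‖) • (1 : Θ → ℝ) + t • d (φ n) ∈ Set.Ici (0 : Θ → ℝ) := by
      filter_upwards [hev] with n hn
      exact add_nonneg (smul_nonneg (hcoef n hn) zero_le_one)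
        (smul_nonneg ht.le (smul_nonneg (inv_nonneg.2 (norm_nonneg _)) (hy0 _)))
    have hpt : 1 + t • e ∈ Set.Ici (0 : Θ → ℝ) := add_nonneg zero_le_one (smul_nonneg ht.le he0)
    have hlsc := (tendsto_nhdsWithin_iff.2 ⟨hlimz, hmem⟩).eventually (hf.lsc _ hpt _ hlt)
    obtain ⟨n, hn, hn'⟩ := (hev.and hlsc).exists
    refine absurd hn' (not_lt.2 ?_)
    have h1 := hf.apply_combo_le (x := 1) (y := y (φ n)) zero_le_one (hy0 _) (hcoef n hn)
      (b := t / ‖y (φ n)‖) (by positivity) (by ring)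
    have h2 : t • d (φ n) = (t / ‖y (φ n)‖) • y (φ n) := by
      simp only [d, smul_smul, div_eq_mul_inv]
    rw [h2]
    refine h1.trans ?_
    rw [hf.one, mul_zero, zero_add]
    calc ENNReal.ofReal (t / ‖y (φ n)‖) * f (y (φ n))
        ≤ ENNReal.ofReal (t / ‖y (φ n)‖) * ENNReal.ofReal (M * ‖y (φ n)‖) := by
          gcongr
          refine (hy _).le.trans (ENNReal.ofReal_le_ofReal ?_)
          linarith [(Nat.cast_nonneg (φ n) : (0 : ℝ) ≤ φ n)]
      _ = ENNReal.ofReal (t * M) := by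
          rw [← ENNReal.ofReal_mul (by positivity)]
          congr 1
          have := (hypos (φ n)).ne'
          field_simp
  have htop := hc 1 hf.one_mem_dom e he0 hene
  have hev := htop.eventually (lt_mem_nhds (ENNReal.ofReal_lt_top (r := M)))
  obtain ⟨t, ht, ht0⟩ := (hev.and (eventually_gt_atTop 0)).exists
  refine absurd ht (not_lt.2 ?_)
  refine ENNReal.div_le_of_le_mul ((hbound t ht0).trans_eq ?_)
  rw [mul_comm, ENNReal.ofReal_mul hM.le]

lemma norm_growth (hf : IsGenerator f) (hc : IsCofinite f) {M : ℝ} (hM : 0 < M) :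
    ∃ c : ℝ, ∀ y ∈ dom f, M * ‖y‖ - c ≤ (f y).toReal := by
  obtain ⟨c, h⟩ := exists_growth hf hc hM
  refine ⟨c, fun y hy => ?_⟩
  rw [← ENNReal.ofReal_le_iff_le_toReal hy.2.ne]
  exact h y hy.1

lemma dotProduct_le_norm (v y : Θ → ℝ) : v ⬝ᵥ y ≤ (∑ θ, |v θ|) * ‖y‖ := by
  rw [dotProduct, Finset.sum_mul]
  refine Finset.sum_le_sum fun θ _ => (le_abs_self _).trans ?_
  rw [abs_mul]
  exact mul_le_mul_of_nonneg_left (norm_le_pi_norm y θ) (abs_nonneg _)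

end Growth

/-! ### Attainment, uniqueness and differentiability for the conjugate. -/

section Conjugate

variable {Θ : Type*} [Fintype Θ] {f : (Θ → ℝ) → ℝ≥0∞}

/-- `y` attains the supremum that defines `f⋆ (v)`. -/
def IsConjMax (f : (Θ → ℝ) → ℝ≥0∞) (v y : Θ → ℝ) : Prop :=
  y ∈ dom f ∧ ∀ z ∈ dom f, v ⬝ᵥ z - (f z).toReal ≤ v ⬝ᵥ y - (f y).toReal

lemma isCompact_orthant_inter_closedBall (R : ℝ) :
    IsCompact (Set.Ici (0 : Θ → ℝ) ∩ Metric.closedBall 0 R) :=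
  (isCompact_closedBall 0 R).inter_left isClosed_Ici

lemma continuous_dotProduct_right (v : Θ → ℝ) : Continuous fun y : Θ → ℝ => v ⬝ᵥ y :=
  continuous_const.dotProduct continuous_id

lemma exists_isConjMax (hf : IsGenerator f) (hc : IsCofinite f) (v : Θ → ℝ) :
    ∃ y, IsConjMax f v y := by
  have hS : 0 ≤ ∑ θ, |v θ| := Finset.sum_nonneg fun _ _ => abs_nonneg _
  obtain ⟨c, hgrow⟩ := norm_growth hf hc (M := ∑ θ, |v θ| + 1) (by positivity)
  -- Growth with slope `∑ |v θ| + 1` gives `v ⬝ᵥ z - f z ≤ c - ‖z‖`, so beyond this radius every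
  -- point does worse than `1`.
  set R := max ‖(1 : Θ → ℝ)‖ (c - v ⬝ᵥ 1)
  have h1 : (1 : Θ → ℝ) ∈ Set.Ici (0 : Θ → ℝ) ∩ Metric.closedBall 0 R :=
    ⟨hf.one_mem_dom.1, by simp [R]⟩
  obtain ⟨y, hy, hmax⟩ := exists_max_sub (isCompact_orthant_inter_closedBall R) ⟨1, h1⟩
    (hf.lsc.mono Set.inter_subset_left) (continuous_dotProduct_right v).continuousOn
  obtain ⟨hytop, hy1⟩ := hmax 1 h1 hf.one_mem_dom.2.ne
  refine ⟨y, ⟨hy.1, lt_top_iff_ne_top.2 hytop⟩, fun z hz => ?_⟩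
  by_cases hzR : ‖z‖ ≤ R
  · exact (hmax z ⟨hz.1, by simpa using hzR⟩ hz.2.ne).2
  · rw [hf.one, ENNReal.toReal_zero] at hy1
    have := hgrow z hz
    have := dotProduct_le_norm v z
    have := le_max_right ‖(1 : Θ → ℝ)‖ (c - v ⬝ᵥ 1)
    have : c - v ⬝ᵥ 1 ≤ R := this
    linarith

lemma IsConjMax.conj_eq {v y : Θ → ℝ} (h : IsConjMax f v y) :
    conj f v = ((v ⬝ᵥ y - (f y).toReal : ℝ) : EReal) := by
  have hcoe : ∀ z ∈ dom f, ((f z : ℝ≥0∞) : EReal) = (((f z).toReal : ℝ) : EReal) := fun z hz =>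
    (EReal.coe_ennreal_toReal hz.2.ne).symm
  refine le_antisymm (iSup₂_le fun z hz => ?_) ?_
  · by_cases hzt : f z = ⊤
    · simp [hzt]
    · have hz' : z ∈ dom f := ⟨hz, lt_top_iff_ne_top.2 hzt⟩
      rw [hcoe z hz', ← EReal.coe_sub, EReal.coe_le_coe_iff]
      exact h.2 z hz'
  · refine le_trans (le_of_eq ?_) (le_iSup₂ (f := fun (z : Θ → ℝ) (_ : z ∈ Set.Ici 0) =>
      ((∑ θ, v θ * z θ : ℝ) : EReal) - ((f z : ℝ≥0∞) : EReal)) y h.1.1)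
    rw [hcoe y h.1, ← EReal.coe_sub]
    rfl

lemma IsConjMax.toReal_conj {v y : Θ → ℝ} (h : IsConjMax f v y) :
    (conj f v).toReal = v ⬝ᵥ y - (f y).toReal := by
  rw [h.conj_eq, EReal.toReal_coe]

lemma coe_toReal_conj (hf : IsGenerator f) (hc : IsCofinite f) (v : Θ → ℝ) :
    (((conj f v).toReal : ℝ) : EReal) = conj f v := by
  obtain ⟨y, hy⟩ := exists_isConjMax hf hc v
  rw [hy.toReal_conj, hy.conj_eq]

/-- The Fenchel–Young inequality. -/
lemma fenchel_young (hf : IsGenerator f) (hc : IsCofinite f) (v : Θ → ℝ) {z : Θ → ℝ}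
    (hz : z ∈ dom f) : v ⬝ᵥ z - (f z).toReal ≤ (conj f v).toReal := by
  obtain ⟨y, hy⟩ := exists_isConjMax hf hc v
  rw [hy.toReal_conj]
  exact hy.2 z hz

lemma IsConjMax.mem_subdiff {v y : Θ → ℝ} (h : IsConjMax f v y) : v ∈ subdiff f y := by
  intro z hz
  by_cases hzt : f z = ⊤
  · simp [hzt]
  · have hz' : z ∈ dom f := ⟨hz, lt_top_iff_ne_top.2 hzt⟩
    have hs : ∑ θ, v θ * (z θ - y θ) = v ⬝ᵥ z - v ⬝ᵥ y := by
      simp [dotProduct, mul_sub]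
    rw [← EReal.coe_ennreal_toReal hz'.2.ne, ← EReal.coe_ennreal_toReal h.1.2.ne,
      ← EReal.coe_add, EReal.coe_le_coe_iff, hs]
    linarith [h.2 z hz']

lemma IsConjMax.combo (hf : IsGenerator f) {v y z : Θ → ℝ} (hy : IsConjMax f v y)
    (hz : IsConjMax f v z) {a b : ℝ} (ha : 0 ≤ a) (hb : 0 ≤ b) (hab : a + b = 1) :
    IsConjMax f v (a • y + b • z) := by
  obtain ⟨hmem, hle⟩ := hf.combo_mem_dom hy.1 hz.1 ha hb hab
  refine ⟨hmem, fun w hw => ?_⟩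
  have h1 := mul_le_mul_of_nonneg_left (hy.2 w hw) ha
  have h2 := mul_le_mul_of_nonneg_left (hz.2 w hw) hb
  rw [dotProduct_add, dotProduct_smul, dotProduct_smul, smul_eq_mul, smul_eq_mul]
  have h3 : v ⬝ᵥ w - (f w).toReal = (a + b) * (v ⬝ᵥ w - (f w).toReal) := by rw [hab, one_mul]
  linarith

/-- The maximizers for `v` form a convex set on which `v` is a subgradient, so `f` is strictly
convex there, and the midpoint of two distinct maximizers would beat both. -/
lemma IsConjMax.unique (hf : IsGenerator f) (hs : IsEssStrictConvex f) {v y z : Θ → ℝ}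
    (hy : IsConjMax f v y) (hz : IsConjMax f v z) : y = z := by
  by_contra hne
  have hstrict := hs {w | IsConjMax f v w} (fun w hw => ⟨hw.1.1, v, hw.mem_subdiff⟩)
    (fun w hw w' hw' a b ha hb hab => IsConjMax.combo hf hw hw' ha hb hab)
  have hhalf : (1 / 2 : ℝ≥0) + 1 / 2 = 1 := by norm_num
  have hlt : f ((1 / 2 : ℝ≥0) • y + (1 / 2 : ℝ≥0) • z) <
      (1 / 2 : ℝ≥0) • f y + (1 / 2 : ℝ≥0) • f z :=
    hstrict.2 hy hz hne (by norm_num) (by norm_num) hhalf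
  have he : ENNReal.ofReal (1 / 2) = ((1 / 2 : ℝ≥0) : ℝ≥0∞) := by
    rw [ENNReal.ofReal]
    congr 1
    ext
    norm_num
  have hcomb := toReal_combo hy.1 hz.1 (a := 1 / 2) (b := 1 / 2) (by norm_num) (by norm_num)
  rw [he] at hcomb
  have htop : ((1 / 2 : ℝ≥0) : ℝ≥0∞) * f y + ((1 / 2 : ℝ≥0) : ℝ≥0∞) * f z ≠ ⊤ :=
    ENNReal.add_ne_top.2 ⟨ENNReal.mul_ne_top ENNReal.coe_ne_top hy.1.2.ne,
      ENNReal.mul_ne_top ENNReal.coe_ne_top hz.1.2.ne⟩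
  have hlt' := ENNReal.toReal_strict_mono htop hlt
  rw [hcomb] at hlt'
  have hmid : (1 / 2 : ℝ≥0) • y + (1 / 2 : ℝ≥0) • z = (1 / 2 : ℝ) • y + (1 / 2 : ℝ) • z := by
    rw [NNReal.smul_def, NNReal.smul_def]
    norm_num
  rw [hmid] at hlt'
  have hm : IsConjMax f v ((1 / 2 : ℝ) • y + (1 / 2 : ℝ) • z) :=
    IsConjMax.combo hf hy hz (by norm_num) (by norm_num) (by norm_num)
  have h1 := hy.2 _ hm.1
  have h2 := hz.2 _ hm.1
  rw [dotProduct_add, dotProduct_smul, dotProduct_smul, smul_eq_mul, smul_eq_mul] at h1 h2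
  linarith

lemma sum_abs_le_card_mul_norm (v : Θ → ℝ) : ∑ θ, |v θ| ≤ Fintype.card Θ * ‖v‖ := by
  have h := Finset.sum_le_card_nsmul Finset.univ (fun θ => |v θ|) ‖v‖ fun θ _ => norm_le_pi_norm v θ
  simpa [nsmul_eq_mul] using h

lemma dotProduct_le_card_mul (v y : Θ → ℝ) : v ⬝ᵥ y ≤ Fintype.card Θ * ‖v‖ * ‖y‖ :=
  (dotProduct_le_norm v y).trans
    (mul_le_mul_of_nonneg_right (sum_abs_le_card_mul_norm v) (norm_nonneg _))

/-- Comparison with the competitor `1`, with growth constants uniform over slopes within distance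
`1` of `v`. -/
lemma exists_bound_isConjMax (hf : IsGenerator f) (hc : IsCofinite f) (v : Θ → ℝ) :
    ∃ R : ℝ, ∀ w, ‖w - v‖ ≤ 1 → ∀ y, IsConjMax f w y → ‖y‖ ≤ R := by
  set S : ℝ := Fintype.card Θ * (‖v‖ + 1)
  have hS : 0 ≤ S := by positivity
  obtain ⟨c, hgrow⟩ := norm_growth hf hc (M := S + 1) (by positivity)
  refine ⟨c + S * ‖(1 : Θ → ℝ)‖, fun w hw y hy => ?_⟩
  have hwn : ‖w‖ ≤ ‖v‖ + 1 := by
    have := norm_add_le v (w - v)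
    rw [add_sub_cancel] at this
    linarith
  have hdot : ∀ x : Θ → ℝ, w ⬝ᵥ x ≤ S * ‖x‖ := fun x =>
    (dotProduct_le_card_mul w x).trans (mul_le_mul_of_nonneg_right
      (mul_le_mul_of_nonneg_left hwn (Nat.cast_nonneg _)) (norm_nonneg _))
  have h1 := hy.2 1 hf.one_mem_dom
  rw [hf.one, ENNReal.toReal_zero] at h1
  have h2 := hgrow y hy.1
  have h3 := hdot y
  have h4 := hdot (-1)
  rw [dotProduct_neg, norm_neg] at h4
  linarith

/-- The maximizer depends continuously on the slope. -/
lemma IsConjMax.near (hf : IsGenerator f) (hc : IsCofinite f) (hs : IsEssStrictConvex f)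
    {v y : Θ → ℝ} (hy : IsConjMax f v y) {ε : ℝ} (hε : 0 < ε) :
    ∃ δ > 0, ∀ w, ‖w - v‖ < δ → ∀ z, IsConjMax f w z → ‖z - y‖ < ε := by
  obtain ⟨R, hR⟩ := exists_bound_isConjMax hf hc v
  have hyR : ‖y‖ ≤ R := hR v (by simp) y hy
  have hR0 : 0 ≤ R := (norm_nonneg y).trans hyR
  set K : Set (Θ → ℝ) := (Set.Ici 0 ∩ Metric.closedBall 0 R) \ Metric.ball y ε
  have hK : IsCompact K := (isCompact_orthant_inter_closedBall R).diff Metric.isOpen_ball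
  have hmemK : ∀ w, ‖w - v‖ ≤ 1 → ∀ z, IsConjMax f w z → ¬ ‖z - y‖ < ε → z ∈ K := by
    intro w hw z hz hzy
    refine ⟨⟨hz.1.1, by simpa using hR w hw z hz⟩, ?_⟩
    rwa [Metric.mem_ball, dist_eq_norm]
  by_cases hne : ∃ z ∈ K, f z ≠ ⊤
  swap
  · refine ⟨1, one_pos, fun w hw z hz => ?_⟩
    by_contra hcon
    exact hne ⟨z, hmemK w hw.le z hz hcon, hz.1.2.ne⟩
  obtain ⟨z₁, hz₁, hz₁top⟩ := hne
  obtain ⟨z₀, hz₀, hmax⟩ := exists_max_sub hK ⟨z₁, hz₁⟩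
    (hf.lsc.mono (Set.sdiff_subset.trans Set.inter_subset_left))
    (continuous_dotProduct_right v).continuousOn
  have hz₀dom : z₀ ∈ dom f := ⟨hz₀.1.1, lt_top_iff_ne_top.2 (hmax z₁ hz₁ hz₁top).1⟩
  -- The loss from staying at least `ε` away from `y`; it is positive because the maximizer is
  -- unique.
  set gap := (v ⬝ᵥ y - (f y).toReal) - (v ⬝ᵥ z₀ - (f z₀).toReal) with hgap
  have hgap0 : 0 < gap := by
    by_contra! hle
    have : IsConjMax f v z₀ := ⟨hz₀dom, fun z hz => by linarith [hy.2 z hz]⟩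
    refine hz₀.2 ?_
    rw [← hy.unique hf hs this]
    exact Metric.mem_ball_self hε
  set n : ℝ := (Fintype.card Θ : ℝ)
  have hn : 0 ≤ n := Nat.cast_nonneg _
  -- A slope change of norm `δ` alters the comparison of `z` with `y` by at most `n * δ * (2 * R)`,
  -- which must stay below `gap`.
  refine ⟨min 1 (gap / (n * (2 * R) + 1)), by positivity, fun w hw z hz => ?_⟩
  by_contra hcon
  have hw1 : ‖w - v‖ ≤ 1 := hw.le.trans (min_le_left _ _)
  have h1 := (hmax z (hmemK w hw1 z hz hcon) hz.1.2.ne).2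
  have h2 := hz.2 y hy.1
  have h3 : (w - v) ⬝ᵥ (z - y) = w ⬝ᵥ z - w ⬝ᵥ y - (v ⬝ᵥ z - v ⬝ᵥ y) := by
    simp only [sub_dotProduct, dotProduct_sub]
    ring
  have h4 := dotProduct_le_card_mul (w - v) (z - y)
  have h5 : ‖z - y‖ ≤ 2 * R := (norm_sub_le _ _).trans (by linarith [hR w hw1 z hz])
  have h6 : n * ‖w - v‖ * ‖z - y‖ ≤ n * ‖w - v‖ * (2 * R) := by gcongr
  have h7 := (lt_div_iff₀ (by positivity)).1 (hw.trans_le (min_le_right _ _))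
  nlinarith [norm_nonneg (w - v)]

/-- If `z` is the maximizer at `w`, testing each maximizer in the other problem puts the first-order
remainder between `0` and `(w - v) ⬝ᵥ (z - y)`, which is `o(‖w - v‖)` because `z` tends to `y`. -/
lemma IsConjMax.hasFDerivAt (hf : IsGenerator f) (hc : IsCofinite f) (hs : IsEssStrictConvex f)
    {v y : Θ → ℝ} (hy : IsConjMax f v y) :
    HasFDerivAt (fun w => (conj f w).toReal)
      (∑ θ, y θ • ContinuousLinearMap.proj (R := ℝ) (φ := fun _ : Θ => ℝ) θ) v := by
  refine HasFDerivAt.of_isLittleO (Asymptotics.isLittleO_iff.2 fun ε hε => ?_)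
  set n : ℝ := (Fintype.card Θ : ℝ)
  have hn : 0 ≤ n := Nat.cast_nonneg _
  obtain ⟨δ, hδ, hnear⟩ := hy.near hf hc hs (ε := ε / (n + 1)) (by positivity)
  filter_upwards [Metric.ball_mem_nhds v hδ] with w hw
  rw [Metric.mem_ball, dist_eq_norm] at hw
  obtain ⟨z, hz⟩ := exists_isConjMax hf hc w
  have hL : (∑ θ, y θ • ContinuousLinearMap.proj (R := ℝ) (φ := fun _ : Θ => ℝ) θ) (w - v) =
      (w - v) ⬝ᵥ y := by
    simp [dotProduct, mul_comm]
  rw [hL, hz.toReal_conj, hy.toReal_conj, Real.norm_eq_abs, sub_dotProduct]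
  have h1 := hz.2 y hy.1
  have h2 := hy.2 z hz.1
  have h3 : (w - v) ⬝ᵥ (z - y) = w ⬝ᵥ z - w ⬝ᵥ y - (v ⬝ᵥ z - v ⬝ᵥ y) := by
    simp only [sub_dotProduct, dotProduct_sub]
    ring
  have h4 := dotProduct_le_card_mul (w - v) (z - y)
  have h5 := (hnear w hw z hz).le
  have h6 : n * ‖w - v‖ * ‖z - y‖ ≤ n * ‖w - v‖ * (ε / (n + 1)) := by gcongr
  have h7 : n * ‖w - v‖ * (ε / (n + 1)) ≤ ε * ‖w - v‖ := by
    have : n / (n + 1) ≤ 1 := by rw [div_le_one (by positivity)]; linarith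
    calc n * ‖w - v‖ * (ε / (n + 1)) = n / (n + 1) * (ε * ‖w - v‖) := by ring
      _ ≤ 1 * (ε * ‖w - v‖) := by gcongr
      _ = ε * ‖w - v‖ := one_mul _
  rw [abs_le]
  constructor
  · have : 0 ≤ ε * ‖w - v‖ := by positivity
    linarith
  · linarith

lemma IsConjMax.gradConj_eq [DecidableEq Θ] (hf : IsGenerator f) (hc : IsCofinite f)
    (hs : IsEssStrictConvex f) {v y : Θ → ℝ} (hy : IsConjMax f v y) : gradConj f v = y := by
  ext θ
  rw [gradConj, (hy.hasFDerivAt hf hc hs).fderiv]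
  simp [Pi.single_apply]

lemma isConjMax_gradConj [DecidableEq Θ] (hf : IsGenerator f) (hc : IsCofinite f)
    (hs : IsEssStrictConvex f) (v : Θ → ℝ) : IsConjMax f v (gradConj f v) := by
  obtain ⟨y, hy⟩ := exists_isConjMax hf hc v
  rwa [hy.gradConj_eq hf hc hs]

end Conjugate

/-! ### The perspective of the generator. -/

section Perspective

variable {Θ : Type*} {f : (Θ → ℝ) → ℝ≥0∞}

lemma persp_of_ne_zero {r : ℝ} (hr : r ≠ 0) (x : Θ → ℝ) :
    persp f r x = ENNReal.ofReal r * f (r⁻¹ • x) := by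
  have : (fun θ => x θ / r) = r⁻¹ • x := by
    ext θ
    simp [div_eq_inv_mul]
  rw [persp, if_neg hr, this]

lemma persp_zero (x : Θ → ℝ) : persp f 0 x = recession f x := if_pos rfl

lemma persp_smul (hf : IsGenerator f) {r : ℝ} {y : Θ → ℝ} :
    persp f r (r • y) = ENNReal.ofReal r * f y := by
  by_cases hr : r = 0
  · simp [hr, persp_zero, recession_zero hf]
  · rw [persp_of_ne_zero hr, smul_smul, inv_mul_cancel₀ hr, one_smul]

/-- Absolute continuity: at `r = 0` co-finiteness forces `x = 0`, and any point of `dom f` then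
serves as the ratio. -/
lemma exists_eq_smul_of_persp_ne_top (hf : IsGenerator f) (hc : IsCofinite f) {r : ℝ} (hr : 0 ≤ r)
    {x : Θ → ℝ} (hx : 0 ≤ x) (h : persp f r x ≠ ⊤) : ∃ y ∈ dom f, x = r • y := by
  by_cases hr0 : r = 0
  · subst hr0
    refine ⟨1, hf.one_mem_dom, ?_⟩
    by_contra hx0
    rw [zero_smul] at hx0
    exact h (by rw [persp_zero, recession_of_ne_zero hf hc hx hx0])
  · have hpos : 0 < r := lt_of_le_of_ne hr (Ne.symm hr0)
    refine ⟨r⁻¹ • x, ⟨smul_nonneg (inv_nonneg.2 hr) hx, ?_⟩, ?_⟩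
    · rw [persp_of_ne_zero hr0] at h
      refine lt_top_iff_ne_top.2 fun htop => h ?_
      rw [htop, ENNReal.mul_top]
      simpa using hpos
    · rw [smul_smul, mul_inv_cancel₀ hr0, one_smul]

/-- Joint convexity of the perspective on the cone over `dom f`. -/
lemma IsGenerator.exists_smul_add_smul (hf : IsGenerator f) {x y : Θ → ℝ} (hx : x ∈ dom f)
    (hy : y ∈ dom f) {p q : ℝ} (hp : 0 ≤ p) (hq : 0 ≤ q) :
    ∃ z ∈ dom f, p • x + q • y = (p + q) • z ∧
      (p + q) * (f z).toReal ≤ p * (f x).toReal + q * (f y).toReal := by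
  rcases (add_nonneg hp hq).eq_or_lt with h | h
  · obtain ⟨rfl, rfl⟩ := (add_eq_zero_iff_of_nonneg hp hq).1 h.symm
    exact ⟨1, hf.one_mem_dom, by simp, by simp⟩
  · obtain ⟨hmem, hle⟩ := hf.combo_mem_dom hx hy (a := p / (p + q)) (b := q / (p + q))
      (by positivity) (by positivity) (by field_simp)
    refine ⟨_, hmem, ?_, ?_⟩
    · rw [smul_add, smul_smul, smul_smul, mul_div_cancel₀ _ h.ne', mul_div_cancel₀ _ h.ne']
    · calc _ ≤ (p + q) * (p / (p + q) * (f x).toReal + q / (p + q) * (f y).toReal) := by gcongr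
        _ = _ := by field_simp

end Perspective

/-! ### Joint lower semicontinuity of the perspective and the divergence. -/

section Lsc

variable {Θ : Type*} [Fintype Θ] {f : (Θ → ℝ) → ℝ≥0∞}

lemma lowerSemicontinuousOn_persp (hf : IsGenerator f) (hc : IsCofinite f) :
    LowerSemicontinuousOn (fun p : ℝ × (Θ → ℝ) => persp f p.1 p.2) (Set.Ici 0) := by
  rintro ⟨r, x⟩ ⟨hr, hx⟩ b hb
  change 0 ≤ r at hr
  change 0 ≤ x at hx
  change b < persp f r x at hb
  rcases hr.eq_or_lt with rfl | hr
  · by_cases hx0 : x = 0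
    · subst hx0
      rw [persp_zero, recession_zero hf] at hb
      exact absurd hb not_lt_zero
    · have hxn : 0 < ‖x‖ := norm_pos_iff.2 hx0
      have hbtop : b ≠ ⊤ := hb.ne_top
      -- Growth gives `s * f (z / s) ≥ M * ‖z‖ - c * s`, which tends to `M * ‖x‖ = b + 1 > b` as
      -- `(s, z)` tends to `(0, x)`.
      set M := (b.toReal + 1) / ‖x‖
      have hM : 0 < M := by positivity
      obtain ⟨c, hgrow⟩ := exists_growth hf hc hM
      have hcont : Continuous fun p : ℝ × (Θ → ℝ) => M * ‖p.2‖ - c * p.1 := by fun_prop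
      have hval : b.toReal < M * ‖x‖ - c * 0 := by
        simp only [M, div_mul_cancel₀ _ hxn.ne']
        linarith
      have hne : ∀ᶠ p : ℝ × (Θ → ℝ) in 𝓝 (0, x), p.2 ≠ 0 :=
        continuous_snd.continuousAt.eventually_ne hx0
      have hev : ∀ᶠ p : ℝ × (Θ → ℝ) in 𝓝 (0, x), b.toReal < M * ‖p.2‖ - c * p.1 :=
        hcont.continuousAt.eventually (lt_mem_nhds hval)
      filter_upwards [hev.filter_mono nhdsWithin_le_nhds, hne.filter_mono nhdsWithin_le_nhds,
        self_mem_nhdsWithin]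
      rintro ⟨s, z⟩ hlt hz0 ⟨hs, hz⟩
      change 0 ≤ s at hs
      change 0 ≤ z at hz
      change b < persp f s z
      rcases hs.eq_or_lt with rfl | hs
      · rw [persp_zero, recession_of_ne_zero hf hc hz hz0]
        exact lt_top_iff_ne_top.2 hbtop
      · rw [persp_of_ne_zero hs.ne']
        calc b = ENNReal.ofReal b.toReal := (ENNReal.ofReal_toReal hbtop).symm
          _ < ENNReal.ofReal (M * ‖z‖ - c * s) :=
            (ENNReal.ofReal_lt_ofReal_iff (ENNReal.toReal_nonneg.trans_lt hlt)).2 hlt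
          _ = ENNReal.ofReal s * ENNReal.ofReal (M * ‖s⁻¹ • z‖ - c) := by
            rw [← ENNReal.ofReal_mul hs.le, norm_smul, norm_inv, Real.norm_of_nonneg hs.le]
            congr 1
            field_simp
          _ ≤ _ := by
            gcongr
            exact hgrow _ (smul_nonneg (inv_nonneg.2 hs.le) hz)
  · have hr0 : ENNReal.ofReal r ≠ 0 := by simpa using hr
    rw [persp_of_ne_zero hr.ne', mul_comm,
      ← ENNReal.div_lt_iff (.inl hr0) (.inl ENNReal.ofReal_ne_top)] at hb
    obtain ⟨d, hbd, hdf⟩ := exists_between hb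
    have h1 : Tendsto (fun p : ℝ × (Θ → ℝ) => b / ENNReal.ofReal p.1) (𝓝 (r, x))
        (𝓝 (b / ENNReal.ofReal r)) :=
      ENNReal.Tendsto.const_div
        ((ENNReal.continuous_ofReal.comp continuous_fst).tendsto (r, x)) (.inl ENNReal.ofReal_ne_top)
    have h2 : ContinuousAt (fun p : ℝ × (Θ → ℝ) => p.1⁻¹ • p.2) (r, x) :=
      (continuousAt_fst.inv₀ hr.ne').smul continuousAt_snd
    have h3 : ∀ᶠ p : ℝ × (Θ → ℝ) in 𝓝[Set.Ici 0] (r, x), p.1⁻¹ • p.2 ∈ Set.Ici (0 : Θ → ℝ) := by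
      filter_upwards [self_mem_nhdsWithin] with p hp
      exact smul_nonneg (inv_nonneg.2 hp.1) hp.2
    have h4 := (tendsto_nhdsWithin_iff.2 ⟨h2.tendsto.mono_left nhdsWithin_le_nhds, h3⟩).eventually
      (hf.lsc _ (smul_nonneg (inv_nonneg.2 hr.le) hx) _ hdf)
    have hpos : ∀ᶠ p : ℝ × (Θ → ℝ) in 𝓝 (r, x), 0 < p.1 :=
      continuous_fst.continuousAt.eventually (lt_mem_nhds hr)
    filter_upwards [(h1.eventually (gt_mem_nhds hbd)).filter_mono nhdsWithin_le_nhds, h4,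
      hpos.filter_mono nhdsWithin_le_nhds] with p hp1 hp2 hp3
    rw [persp_of_ne_zero hp3.ne', mul_comm, gt_iff_lt,
      ← ENNReal.div_lt_iff (.inl (by simpa using hp3)) (.inl ENNReal.ofReal_ne_top)]
    exact hp1.trans hp2

lemma lowerSemicontinuousOn_divergence {Ω : Type*} [Fintype Ω] (hf : IsGenerator f)
    (hc : IsCofinite f) :
    LowerSemicontinuousOn (fun p : (Θ → Ω → ℝ) × (Ω → ℝ) => divergence f p.1 p.2)
      {p | 0 ≤ p.1 ∧ 0 ≤ p.2} := by
  refine lowerSemicontinuousOn_sum fun ω _ => ?_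
  have hg : Continuous fun p : (Θ → Ω → ℝ) × (Ω → ℝ) => (p.2 ω, fun θ => p.1 θ ω) := by fun_prop
  exact (lowerSemicontinuousOn_persp hf hc).comp hg.continuousOn
    fun p hp => ⟨hp.2 ω, fun θ => hp.1 θ ω⟩

end Lsc

/-! ### The joint problem in `(P, α)`, its Lagrangian dual and the first-order condition. -/

section JointOptimization

section Weighted

variable {Θ Ω : Type*} [Fintype Ω] {f : (Θ → ℝ) → ℝ≥0∞}

lemma divergence_mul (hf : IsGenerator f) {P : Θ → Ω → ℝ} {α : Ω → ℝ} {y : Ω → Θ → ℝ}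
    (hP : ∀ θ ω, P θ ω = α ω * y ω θ) :
    divergence f P α = ∑ ω, ENNReal.ofReal (α ω) * f (y ω) := by
  refine Finset.sum_congr rfl fun ω _ => ?_
  have : (fun θ => P θ ω) = α ω • y ω := by
    ext θ
    exact hP θ ω
  rw [this, persp_smul hf]

lemma toReal_divergence_mul (hf : IsGenerator f) {P : Θ → Ω → ℝ} {α : Ω → ℝ} (hα : 0 ≤ α)
    {y : Ω → Θ → ℝ} (hy : ∀ ω, y ω ∈ dom f) (hP : ∀ θ ω, P θ ω = α ω * y ω θ) :
    divergence f P α ≠ ⊤ ∧ (divergence f P α).toReal = ∑ ω, α ω * (f (y ω)).toReal := by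
  have hne : ∀ ω ∈ Finset.univ, ENNReal.ofReal (α ω) * f (y ω) ≠ ⊤ := fun ω _ =>
    ENNReal.mul_ne_top ENNReal.ofReal_ne_top (hy ω).2.ne
  rw [divergence_mul hf hP]
  refine ⟨ENNReal.sum_ne_top.2 hne, ?_⟩
  rw [ENNReal.toReal_sum hne]
  refine Finset.sum_congr rfl fun ω _ => ?_
  rw [ENNReal.toReal_mul, ENNReal.toReal_ofReal (hα ω)]

lemma exists_ratio (hf : IsGenerator f) (hc : IsCofinite f) {P : Θ → Ω → ℝ} {α : Ω → ℝ}
    (hP : 0 ≤ P) (hα : 0 ≤ α) (h : divergence f P α ≠ ⊤) :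
    ∃ y : Ω → Θ → ℝ, (∀ ω, y ω ∈ dom f) ∧ ∀ θ ω, P θ ω = α ω * y ω θ := by
  have h' : ∀ ω, ∃ y ∈ dom f, (fun θ => P θ ω) = α ω • y := fun ω =>
    exists_eq_smul_of_persp_ne_top hf hc (hα ω) (fun θ => hP θ ω)
      (ENNReal.sum_ne_top.1 h ω (Finset.mem_univ _))
  choose y hy hPy using h'
  exact ⟨y, hy, fun θ ω => congrFun (hPy ω) θ⟩

/-- The constraint qualification: `dom f` absorbs every direction of its affine span at `1`. -/
lemma exists_pos_one_add_smul_mem (hri : (1 : Θ → ℝ) ∈ intrinsicInterior ℝ (dom f)) {w : Θ → ℝ}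
    (hw : w ∈ (affineSpan ℝ (dom f)).direction) : ∃ t : ℝ, 0 < t ∧ 1 + t • w ∈ dom f := by
  obtain ⟨p, hp, hp1⟩ := mem_intrinsicInterior.1 hri
  have hmem : ∀ t : ℝ, 1 + t • w ∈ affineSpan ℝ (dom f) := fun t => by
    rw [← hp1, add_comm]
    exact AffineSubspace.vadd_mem_of_mem_direction (Submodule.smul_mem _ t hw) p.2
  let γ : ℝ → affineSpan ℝ (dom f) := fun t => ⟨1 + t • w, hmem t⟩
  have hγ : Continuous γ := Continuous.subtype_mk (by fun_prop) _
  have hγ0 : γ 0 = p := Subtype.ext (by simp [γ, hp1])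
  have hev : ∀ᶠ t in 𝓝 (0 : ℝ), γ t ∈ ((↑) ⁻¹' dom f : Set (affineSpan ℝ (dom f))) :=
    hγ.continuousAt.eventually (by rw [hγ0]; exact mem_interior_iff_mem_nhds.1 hp)
  obtain ⟨t, ht, ht0⟩ :=
    ((hev.filter_mono nhdsWithin_le_nhds).and (self_mem_nhdsWithin (s := Set.Ioi (0 : ℝ)))).exists
  exact ⟨t, ht0, ht⟩

end Weighted

variable {Θ Ω : Type*} [Fintype Θ] [Fintype Ω] {f : (Θ → ℝ) → ℝ≥0∞}

lemma exists_isFMean [Nonempty Ω] (hf : IsGenerator f) (hc : IsCofinite f) {P : Θ → Ω → ℝ}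
    (hP : 0 ≤ P) : ∃ α, IsFMean f P α := by
  classical
  have hlsc : LowerSemicontinuousOn (fun α : Ω → ℝ => divergence f P α) (stdSimplex ℝ Ω) := by
    have hg : Continuous fun α : Ω → ℝ => (P, α) := by fun_prop
    exact (lowerSemicontinuousOn_divergence hf hc).comp hg.continuousOn fun α hα => ⟨hP, hα.1⟩
  obtain ⟨α, hα, hmin⟩ := hlsc.exists_isMinOn
    ⟨_, single_mem_stdSimplex ℝ (Classical.arbitrary Ω)⟩ (isCompact_stdSimplex ℝ Ω)
  exact ⟨α, hα, le_antisymm (iInf₂_le α hα) (le_iInf₂ fun β hβ => hmin hβ)⟩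

/-- The linear part of the decision maker's objective, with `u ω` the weighted utility of `ω`. -/
def gain (u : Ω → Θ → ℝ) (P : Θ → Ω → ℝ) : ℝ := ∑ ω, u ω ⬝ᵥ fun θ => P θ ω

/-- `(P, α)` maximizes the gain net of the divergence of `P` from `α`. -/
structure IsJointOpt (f : (Θ → ℝ) → ℝ≥0∞) (u : Ω → Θ → ℝ) (P : Θ → Ω → ℝ) (α : Ω → ℝ) :
    Prop where
  rule : ∀ θ, P θ ∈ stdSimplex ℝ Ω
  mem : α ∈ stdSimplex ℝ Ω
  ne_top : divergence f P α ≠ ⊤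
  le : ∀ Q : Θ → Ω → ℝ, (∀ θ, Q θ ∈ stdSimplex ℝ Ω) → ∀ β ∈ stdSimplex ℝ Ω,
    divergence f Q β ≠ ⊤ →
      gain u Q - (divergence f Q β).toReal ≤ gain u P - (divergence f P α).toReal

lemma exists_isJointOpt [Nonempty Ω] (hf : IsGenerator f) (hc : IsCofinite f) (u : Ω → Θ → ℝ) :
    ∃ P α, IsJointOpt f u P α := by
  classical
  set K : Set ((Θ → Ω → ℝ) × (Ω → ℝ)) :=
    (Set.univ.pi fun _ => stdSimplex ℝ Ω) ×ˢ stdSimplex ℝ Ω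
  have hK : IsCompact K :=
    (isCompact_univ_pi fun _ => isCompact_stdSimplex ℝ Ω).prod (isCompact_stdSimplex ℝ Ω)
  set β : Ω → ℝ := Pi.single (Classical.arbitrary Ω) 1
  have hβ : β ∈ stdSimplex ℝ Ω := single_mem_stdSimplex ℝ _
  have hmem : ((fun _ => β, β) : (Θ → Ω → ℝ) × (Ω → ℝ)) ∈ K := ⟨fun _ _ => hβ, hβ⟩
  have hlsc : LowerSemicontinuousOn
      (fun p : (Θ → Ω → ℝ) × (Ω → ℝ) => divergence f p.1 p.2) K :=
    (lowerSemicontinuousOn_divergence hf hc).mono fun p hp =>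
      ⟨fun θ => (hp.1 θ (Set.mem_univ _)).1, hp.2.1⟩
  have hcont : Continuous fun p : (Θ → Ω → ℝ) × (Ω → ℝ) => gain u p.1 := by
    unfold gain dotProduct
    fun_prop
  obtain ⟨⟨P, α⟩, hPα, hmax⟩ := exists_max_sub hK ⟨_, hmem⟩ hlsc hcont.continuousOn
  -- The uninformative rule, with all likelihood ratios equal to `1`, shows that the problem is
  -- feasible.
  have hfin : divergence f (fun _ : Θ => β) β ≠ ⊤ :=
    (toReal_divergence_mul hf hβ.1 (y := fun _ => 1) (fun _ => hf.one_mem_dom) (by simp)).1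
  exact ⟨P, α, fun θ => hPα.1 θ (Set.mem_univ _), hPα.2, (hmax _ hmem hfin).1,
    fun Q hQ γ hγ h => (hmax (Q, γ) ⟨fun θ _ => hQ θ, hγ⟩ h).2⟩

lemma gain_mul {u : Ω → Θ → ℝ} {P : Θ → Ω → ℝ} {α : Ω → ℝ} {y : Ω → Θ → ℝ}
    (hP : ∀ θ ω, P θ ω = α ω * y ω θ) : gain u P = ∑ ω, α ω * (u ω ⬝ᵥ y ω) := by
  refine Finset.sum_congr rfl fun ω _ => ?_
  have : (fun θ => P θ ω) = α ω • y ω := by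
    ext θ
    exact hP θ ω
  rw [this, dotProduct_smul, smul_eq_mul]

/-- Lets the multiplier term be added to the objective at no cost when each `P θ` sums to one. -/
lemma sum_mul_dotProduct_eq {P : Θ → Ω → ℝ} {α : Ω → ℝ} {y : Ω → Θ → ℝ}
    (hP : ∀ θ ω, P θ ω = α ω * y ω θ) (hrule : ∀ θ, P θ ∈ stdSimplex ℝ Ω) (l : Θ → ℝ) :
    ∑ ω, α ω * (l ⬝ᵥ y ω) = ∑ θ, l θ := by
  simp only [dotProduct, Finset.mul_sum]
  rw [Finset.sum_comm]
  refine Finset.sum_congr rfl fun θ _ => ?_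
  calc ∑ ω, α ω * (l θ * y ω θ) = l θ * ∑ ω, P θ ω := by
        rw [Finset.mul_sum]
        refine Finset.sum_congr rfl fun ω _ => ?_
        rw [hP]
        ring
    _ = l θ := by rw [(hrule θ).2, mul_one]

/-- The net gain as a weighted sum of Lagrangian terms. -/
lemma net_gain_eq (hf : IsGenerator f) {P : Θ → Ω → ℝ} {α : Ω → ℝ} (hα : 0 ≤ α)
    {y : Ω → Θ → ℝ} (hy : ∀ ω, y ω ∈ dom f) (hP : ∀ θ ω, P θ ω = α ω * y ω θ)
    (hrule : ∀ θ, P θ ∈ stdSimplex ℝ Ω) (u : Ω → Θ → ℝ) (l : Θ → ℝ) :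
    gain u P - (divergence f P α).toReal =
      ∑ ω, α ω * ((u ω - l) ⬝ᵥ y ω - (f (y ω)).toReal) + ∑ θ, l θ := by
  rw [(toReal_divergence_mul hf hα hy hP).2, gain_mul hP, ← sum_mul_dotProduct_eq hP hrule l,
    ← Finset.sum_sub_distrib, ← Finset.sum_add_distrib]
  refine Finset.sum_congr rfl fun ω _ => ?_
  rw [sub_dotProduct]
  ring

/-- The objective of the dual problem, as a real number. -/
def realDual (f : (Θ → ℝ) → ℝ≥0∞) (u : Ω → Θ → ℝ) (α : Ω → ℝ) (l : Θ → ℝ) : ℝ :=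
  ∑ ω, α ω * (conj f (u ω - l)).toReal + ∑ θ, l θ

/-- Weak duality: Fenchel–Young in each summand, with weights `α ω ≥ 0`. -/
lemma net_gain_le_realDual (hf : IsGenerator f) (hc : IsCofinite f) {P : Θ → Ω → ℝ} {α : Ω → ℝ}
    (hα : 0 ≤ α) (hrule : ∀ θ, P θ ∈ stdSimplex ℝ Ω) (h : divergence f P α ≠ ⊤)
    (u : Ω → Θ → ℝ) (l : Θ → ℝ) :
    gain u P - (divergence f P α).toReal ≤ realDual f u α l := by
  obtain ⟨y, hy, hP⟩ := exists_ratio hf hc (fun θ => (hrule θ).1) hα h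
  rw [net_gain_eq hf hα hy hP hrule u l, realDual]
  gcongr with ω
  · exact hα ω
  · exact fenchel_young hf hc _ (hy ω)

/-- Lagrange multipliers for the constraints `∑ ω, P θ ω = 1`. -/
lemma IsJointOpt.exists_multiplier (hf : IsGenerator f) (hreg : IsRegular f) {u : Ω → Θ → ℝ}
    {P : Θ → Ω → ℝ} {α : Ω → ℝ} (h : IsJointOpt f u P α) :
    ∃ l : Θ → ℝ, ∀ ω, (conj f (u ω - l)).toReal + ∑ θ, l θ ≤
      gain u P - (divergence f P α).toReal := by
  classical
  set V := gain u P - (divergence f P α).toReal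
  -- The hypograph of the value function when the right-hand side `1` of the constraint is replaced
  -- by `z`. It is convex because the perspective is jointly convex.
  let C : Set ((Θ → ℝ) × ℝ) := {p | ∃ β ∈ stdSimplex ℝ Ω, ∃ y : Ω → Θ → ℝ, (∀ ω, y ω ∈ dom f) ∧
    p.1 = ∑ ω, β ω • y ω ∧ p.2 ≤ ∑ ω, β ω * (u ω ⬝ᵥ y ω - (f (y ω)).toReal)}
  have hC : Convex ℝ C := by
    rintro ⟨z, r⟩ ⟨β, hβ, y, hy, hz, hr⟩ ⟨z', r'⟩ ⟨β', hβ', y', hy', hz', hr'⟩ a b ha hb hab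
    have hex := fun ω => hf.exists_smul_add_smul (hy ω) (hy' ω) (mul_nonneg ha (hβ.1 ω))
      (mul_nonneg hb (hβ'.1 ω))
    choose x hx hxe hxf using hex
    refine ⟨a • β + b • β', convex_stdSimplex ℝ Ω hβ hβ' ha hb hab, x, hx, ?_, ?_⟩
    · change a • z + b • z' = _
      dsimp only at hz hz'
      rw [hz, hz', Finset.smul_sum, Finset.smul_sum, ← Finset.sum_add_distrib]
      refine Finset.sum_congr rfl fun ω _ => ?_
      rw [smul_smul, smul_smul, hxe]
      rfl
    · change a * r + b * r' ≤ _
      calc a * r + b * r' ≤ a * ∑ ω, β ω * (u ω ⬝ᵥ y ω - (f (y ω)).toReal) +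
            b * ∑ ω, β' ω * (u ω ⬝ᵥ y' ω - (f (y' ω)).toReal) := by gcongr
        _ = ∑ ω, (u ω ⬝ᵥ ((a * β ω) • y ω + (b * β' ω) • y' ω) -
            (a * β ω * (f (y ω)).toReal + b * β' ω * (f (y' ω)).toReal)) := by
          rw [Finset.mul_sum, Finset.mul_sum, ← Finset.sum_add_distrib]
          refine Finset.sum_congr rfl fun ω _ => ?_
          rw [dotProduct_add, dotProduct_smul, dotProduct_smul, smul_eq_mul, smul_eq_mul]
          ring
        _ ≤ _ := by
          refine Finset.sum_le_sum fun ω _ => ?_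
          rw [hxe, dotProduct_smul, smul_eq_mul]
          have := hxf ω
          simp only [Pi.add_apply, Pi.smul_apply, smul_eq_mul]
          linarith
  -- Using one common ratio `y` for all `ω` shows that every `z = y ∈ dom f` is feasible.
  have hCsingle : ∀ β ∈ stdSimplex ℝ Ω, ∀ y ∈ dom f,
      (y, ∑ ω, β ω * (u ω ⬝ᵥ y - (f y).toReal)) ∈ C := fun β hβ y hy =>
    ⟨β, hβ, fun _ => y, fun _ => hy, by rw [← Finset.sum_smul, hβ.2, one_smul], le_rfl⟩
  obtain ⟨g, hg⟩ := exists_supergradient (affineSpan ℝ (dom f)).direction hC 1 V (by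
    rintro r ⟨β, hβ, y, hy, hz, hr⟩
    have hQ : ∀ θ, (fun ω => β ω * y ω θ) ∈ stdSimplex ℝ Ω := fun θ =>
      ⟨fun ω => mul_nonneg (hβ.1 ω) ((hy ω).1 θ), by
        have := congrFun hz θ
        simpa using this.symm⟩
    have hdiv := toReal_divergence_mul hf hβ.1 hy (P := fun θ ω => β ω * y ω θ) fun _ _ => rfl
    refine hr.trans (le_trans (le_of_eq ?_) (h.le _ hQ β hβ hdiv.1))
    rw [net_gain_eq hf hβ.1 hy (fun _ _ => rfl) hQ u 0]
    simp) (by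
    intro w hw
    obtain ⟨t, ht, hmem⟩ := exists_pos_one_add_smul_mem hreg.one_mem_ri hw
    exact ⟨t, ht, _, hCsingle α h.mem _ hmem⟩)
  let l : Θ → ℝ := fun θ => g fun j => if θ = j then 1 else 0
  have hgl : ∀ w, g w = l ⬝ᵥ w := fun w => by
    rw [g.pi_apply_eq_sum_univ w]
    exact Finset.sum_congr rfl fun θ _ => mul_comm _ _
  refine ⟨l, fun ω => ?_⟩
  -- The supergradient inequality is tested at the point mass on `ω` with the ratio that attains `f⋆
  -- (u ω - l)`.
  obtain ⟨y, hy⟩ := exists_isConjMax hf hreg.cofinite (u ω - l)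
  have hw : y - 1 ∈ (affineSpan ℝ (dom f)).direction :=
    AffineSubspace.vsub_mem_direction (subset_affineSpan ℝ _ hy.1)
      (subset_affineSpan ℝ _ hf.one_mem_dom)
  have hle := hg _ hw _ (by
    rw [add_sub_cancel]
    exact hCsingle _ (single_mem_stdSimplex ℝ ω) y hy.1)
  have hsum : ∑ ω', (Pi.single ω 1 : Ω → ℝ) ω' * (u ω' ⬝ᵥ y - (f y).toReal) =
      u ω ⬝ᵥ y - (f y).toReal := by
    simp [Pi.single_apply]
  have hl1 : l ⬝ᵥ 1 = ∑ θ, l θ := by simp [dotProduct]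
  rw [hsum, hgl, dotProduct_sub, hl1] at hle
  rw [hy.toReal_conj, sub_dotProduct]
  linarith

lemma realDual_le_of_forall_le {u : Ω → Θ → ℝ} {β : Ω → ℝ} (hβ : β ∈ stdSimplex ℝ Ω) {l : Θ → ℝ}
    {V : ℝ} (h : ∀ ω, (conj f (u ω - l)).toReal + ∑ θ, l θ ≤ V) : realDual f u β l ≤ V := by
  calc realDual f u β l = ∑ ω, β ω * ((conj f (u ω - l)).toReal + ∑ θ, l θ) := by
        simp only [realDual, mul_add, Finset.sum_add_distrib, ← Finset.sum_mul, hβ.2, one_mul]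
    _ ≤ ∑ ω, β ω * V := Finset.sum_le_sum fun ω _ => mul_le_mul_of_nonneg_left (h ω) (hβ.1 ω)
    _ = V := by rw [← Finset.sum_mul, hβ.2, one_mul]

/-- A jointly optimal pair and a multiplier satisfy the first-order condition. -/
lemma IsJointOpt.eq_mul_gradConj [DecidableEq Θ] (hf : IsGenerator f) (hreg : IsRegular f)
    {u : Ω → Θ → ℝ} {P : Θ → Ω → ℝ} {α : Ω → ℝ} (h : IsJointOpt f u P α) {l : Θ → ℝ}
    (hl : realDual f u α l ≤ gain u P - (divergence f P α).toReal) (θ : Θ) (ω : Ω) :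
    P θ ω = α ω * gradConj f (u ω - l) θ := by
  obtain ⟨y, hy, hP⟩ := exists_ratio hf hreg.cofinite (fun θ => (h.rule θ).1) h.mem.1 h.ne_top
  rw [net_gain_eq hf h.mem.1 hy hP h.rule u l, realDual, add_le_add_iff_right] at hl
  have hle : ∀ ω ∈ Finset.univ, α ω * ((u ω - l) ⬝ᵥ y ω - (f (y ω)).toReal) ≤
      α ω * (conj f (u ω - l)).toReal := fun ω _ =>
    mul_le_mul_of_nonneg_left (fenchel_young hf hreg.cofinite _ (hy ω)) (h.mem.1 ω)
  -- No gap in the sum means no gap in any term, so `y ω` attains the conjugate wherever `α ω ≠ 0`.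
  have heq := (Finset.sum_eq_sum_iff_of_le hle).1 (le_antisymm (Finset.sum_le_sum hle) hl) ω
    (Finset.mem_univ _)
  rw [hP]
  by_cases hα : α ω = 0
  · simp [hα]
  · have hmax : IsConjMax f (u ω - l) (y ω) := by
      refine ⟨hy ω, fun z hz => ?_⟩
      rw [mul_left_cancel₀ hα heq]
      exact fenchel_young hf hreg.cofinite _ hz
    rw [hmax.gradConj_eq hf hreg.cofinite hreg.essStrictConvex]

/-- Under the first-order condition the net gain equals the dual objective. -/
lemma net_gain_eq_realDual [DecidableEq Θ] (hf : IsGenerator f) (hreg : IsRegular f)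
    {u : Ω → Θ → ℝ} {P : Θ → Ω → ℝ} {α : Ω → ℝ} (hα : 0 ≤ α) (hrule : ∀ θ, P θ ∈ stdSimplex ℝ Ω)
    {l : Θ → ℝ} (hP : ∀ θ ω, P θ ω = α ω * gradConj f (u ω - l) θ) :
    divergence f P α ≠ ⊤ ∧ gain u P - (divergence f P α).toReal = realDual f u α l := by
  have hmax := fun ω => isConjMax_gradConj hf hreg.cofinite hreg.essStrictConvex (u ω - l)
  refine ⟨(toReal_divergence_mul hf hα (fun ω => (hmax ω).1) hP).1, ?_⟩
  rw [net_gain_eq hf hα (fun ω => (hmax ω).1) hP hrule u l, realDual]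
  simp only [(hmax _).toReal_conj]

end JointOptimization

/-! ### Back to the extended-real problems (1) and (2). -/

section MaxMin

variable {Θ : Type*} [Fintype Θ] {f : (Θ → ℝ) → ℝ≥0∞} {π : Θ → ℝ} {A : Finset (Θ → ℝ)}

/-- The utility profiles of the actions, weighted by the prior. -/
def weighted (π : Θ → ℝ) (A : Finset (Θ → ℝ)) : A → Θ → ℝ := fun a θ => (a : Θ → ℝ) θ * π θ

lemma gain_weighted (P : Θ → A → ℝ) :
    ∑ θ, π θ * ∑ a : A, P θ a * (a : Θ → ℝ) θ = gain (weighted π A) P := by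
  simp only [gain, dotProduct, weighted, Finset.mul_sum]
  rw [Finset.sum_comm]
  exact Finset.sum_congr rfl fun a _ => Finset.sum_congr rfl fun θ _ => by ring

lemma dualObj_eq (hf : IsGenerator f) (hc : IsCofinite f) (α : A → ℝ) (l : Θ → ℝ) :
    dualObj f π α l = ((realDual f (weighted π A) α l : ℝ) : EReal) := by
  have h : ∀ a : A, (α a : EReal) * conj f (shifted π l a) =
      ((α a * (conj f (weighted π A a - l)).toReal : ℝ) : EReal) := fun a => by
    rw [EReal.coe_mul, coe_toReal_conj hf hc]
    rfl
  rw [dualObj, Finset.sum_congr rfl fun a _ => h a, realDual, EReal.coe_add]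
  congr 1
  exact (map_sum (⟨⟨Real.toEReal, EReal.coe_zero⟩, EReal.coe_add⟩ : ℝ →+ EReal) _ _).symm

lemma payoff_eq {P : Θ → A → ℝ} (h : info f P ≠ ⊤) :
    payoff f π P = ((gain (weighted π A) P - (info f P).toReal : ℝ) : EReal) := by
  rw [payoff, gain_weighted, EReal.coe_sub, EReal.coe_ennreal_toReal h]

lemma payoff_of_info_eq_top {P : Θ → A → ℝ} (h : info f P = ⊤) : payoff f π P = ⊥ := by
  simp [payoff, h]

/-- Every net gain is a lower bound of the payoff. -/
lemma net_gain_le_payoff {P : Θ → A → ℝ} {α : A → ℝ} (hα : α ∈ stdSimplex ℝ A)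
    (h : divergence f P α ≠ ⊤) :
    ((gain (weighted π A) P - (divergence f P α).toReal : ℝ) : EReal) ≤ payoff f π P := by
  have hle : info f P ≤ divergence f P α := iInf₂_le α hα
  rw [payoff_eq (ne_top_of_le_ne_top h hle), EReal.coe_le_coe_iff]
  gcongr

lemma payoff_le_of_forall [Nonempty A] (hf : IsGenerator f) (hc : IsCofinite f) {P : Θ → A → ℝ}
    (hP : IsChoiceRule P) {V : ℝ} (h : ∀ α ∈ stdSimplex ℝ A, divergence f P α ≠ ⊤ →
      gain (weighted π A) P - (divergence f P α).toReal ≤ V) : payoff f π P ≤ V := by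
  obtain ⟨α, hα, hinfo⟩ := exists_isFMean hf hc (fun θ => (hP θ).1)
  by_cases htop : info f P = ⊤
  · simp [payoff_of_info_eq_top htop]
  · rw [payoff_eq htop, EReal.coe_le_coe_iff, hinfo]
    exact h α hα (hinfo ▸ htop)

lemma IsJointOpt.payoff_le [Nonempty A] (hf : IsGenerator f) (hc : IsCofinite f)
    {P : Θ → A → ℝ} {α : A → ℝ} (h : IsJointOpt f (weighted π A) P α) {Q : Θ → A → ℝ}
    (hQ : IsChoiceRule Q) :
    payoff f π Q ≤ ((gain (weighted π A) P - (divergence f P α).toReal : ℝ) : EReal) :=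
  payoff_le_of_forall hf hc hQ fun β hβ htop => h.le Q hQ β hβ htop

lemma IsJointOpt.payoff_eq [Nonempty A] (hf : IsGenerator f) (hc : IsCofinite f)
    {P : Θ → A → ℝ} {α : A → ℝ} (h : IsJointOpt f (weighted π A) P α) :
    payoff f π P = ((gain (weighted π A) P - (divergence f P α).toReal : ℝ) : EReal) :=
  le_antisymm (h.payoff_le hf hc h.rule) (net_gain_le_payoff h.mem h.ne_top)

lemma IsJointOpt.isSolution [Nonempty A] (hf : IsGenerator f) (hc : IsCofinite f)
    {P : Θ → A → ℝ} {α : A → ℝ} (h : IsJointOpt f (weighted π A) P α) : IsSolution f π P :=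
  ⟨h.rule, fun _ hQ => (h.payoff_le hf hc hQ).trans_eq (h.payoff_eq hf hc).symm⟩

lemma IsJointOpt.isFMean [Nonempty A] (hf : IsGenerator f) (hc : IsCofinite f)
    {P : Θ → A → ℝ} {α : A → ℝ} (h : IsJointOpt f (weighted π A) P α) : IsFMean f P α := by
  have hle : info f P ≤ divergence f P α := iInf₂_le α h.mem
  have htop : info f P ≠ ⊤ := ne_top_of_le_ne_top h.ne_top hle
  refine ⟨h.mem, (ENNReal.toReal_eq_toReal_iff' htop h.ne_top).1 ?_⟩
  have := h.payoff_eq hf hc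
  rw [FInfo.payoff_eq htop, EReal.coe_eq_coe_iff] at this
  linarith

/-- Any `f`-mean of `P` completes it to a joint optimum; the payoff is not `⊥`, since it dominates
that of some joint optimum. -/
lemma IsSolution.exists_isJointOpt [Nonempty A] (hf : IsGenerator f) (hc : IsCofinite f)
    {P : Θ → A → ℝ} (h : IsSolution f π P) : ∃ α, IsJointOpt f (weighted π A) P α := by
  obtain ⟨Q, β, hopt⟩ := FInfo.exists_isJointOpt hf hc (weighted π A)
  have hge := h.2 Q hopt.rule
  rw [hopt.payoff_eq hf hc] at hge
  have htop : info f P ≠ ⊤ := fun htop => by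
    rw [payoff_of_info_eq_top htop, le_bot_iff] at hge
    exact EReal.coe_ne_bot _ hge
  obtain ⟨α, hα, hinfo⟩ := exists_isFMean hf hc (fun θ => (h.1 θ).1)
  rw [payoff_eq htop, EReal.coe_le_coe_iff, hinfo] at hge
  exact ⟨α, h.1, hα, hinfo ▸ htop, fun R hR γ hγ hfin => (hopt.le R hR γ hγ hfin).trans hge⟩

/-- Weak duality and a multiplier give a saddle point. -/
lemma IsJointOpt.exists_isSaddle (hf : IsGenerator f) (hreg : IsRegular f)
    {P : Θ → A → ℝ} {α : A → ℝ} (h : IsJointOpt f (weighted π A) P α) :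
    ∃ l, IsSaddle f π α l ∧
      realDual f (weighted π A) α l = gain (weighted π A) P - (divergence f P α).toReal := by
  obtain ⟨l, hl⟩ := h.exists_multiplier hf hreg
  have hweak := net_gain_le_realDual hf hreg.cofinite h.mem.1 h.rule h.ne_top (weighted π A)
  refine ⟨l, ⟨h.mem, fun β hβ => ?_, fun m => ?_⟩,
    le_antisymm (realDual_le_of_forall_le h.mem hl) (hweak l)⟩
  -- The multiplier bounds each pure action by the optimal net gain, so every mixture `β` obeys the
  -- same bound at `l`, while weak duality bounds the dual at `α` from below for every `m`.
  · rw [dualObj_eq hf hreg.cofinite, dualObj_eq hf hreg.cofinite, EReal.coe_le_coe_iff]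
    exact (realDual_le_of_forall_le hβ hl).trans (hweak l)
  · rw [dualObj_eq hf hreg.cofinite, dualObj_eq hf hreg.cofinite, EReal.coe_le_coe_iff]
    exact (realDual_le_of_forall_le h.mem hl).trans (hweak m)

/-- A saddle point whose first-order condition yields a choice rule is jointly optimal. -/
lemma IsSaddle.isJointOpt [DecidableEq Θ] (hf : IsGenerator f) (hreg : IsRegular f)
    {P : Θ → A → ℝ} (hP : IsChoiceRule P) {α : A → ℝ} {l : Θ → ℝ} (h : IsSaddle f π α l)
    (hPα : ∀ θ, ∀ a : A, P θ a = α a * gradConj f (shifted π l a) θ) :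
    IsJointOpt f (weighted π A) P α := by
  obtain ⟨htop, heq⟩ := net_gain_eq_realDual (u := weighted π A) hf hreg h.1.1 hP hPα
  refine ⟨hP, h.1, htop, fun Q hQ β hβ hfin => ?_⟩
  rw [heq]
  refine (net_gain_le_realDual hf hreg.cofinite hβ.1 hQ hfin _ l).trans ?_
  have := h.2.1 β hβ
  rwa [dualObj_eq hf hreg.cofinite, dualObj_eq hf hreg.cofinite, EReal.coe_le_coe_iff] at this

end MaxMin

end FInfo

end

theorem theorem2 {Θ : Type*} [Fintype Θ] [DecidableEq Θ]
    (f : (Θ → ℝ) → ℝ≥0∞) (hf : FInfo.IsGenerator f) (hreg : FInfo.IsRegular f)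
    (π : Θ → ℝ) (hπ : π ∈ stdSimplex ℝ Θ) (hπ_pos : ∀ θ, 0 < π θ)
    (A : Finset (Θ → ℝ)) (hA : A.Nonempty) :
    -- the conjugate is finite and differentiable, so that its gradient is meaningful
    ((∀ x, FInfo.conj f x ≠ ⊥ ∧ FInfo.conj f x ≠ ⊤) ∧
      Differentiable ℝ (fun x => (FInfo.conj f x).toReal)) ∧
    -- (i) characterization of the solutions
    (∀ P : Θ → A → ℝ, FInfo.IsChoiceRule P →
      (FInfo.IsSolution f π P ↔
        ∃ (α : A → ℝ) (l : Θ → ℝ), FInfo.IsSaddle f π α l ∧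
          ∀ θ, ∀ a : A, P θ a = α a * FInfo.gradConj f (FInfo.shifted π l a) θ)) ∧
    (∀ P : Θ → A → ℝ, FInfo.IsChoiceRule P → ∀ (α : A → ℝ) (l : Θ → ℝ),
      FInfo.IsSaddle f π α l →
      (∀ θ, ∀ a : A, P θ a = α a * FInfo.gradConj f (FInfo.shifted π l a) θ) →
      FInfo.IsFMean f P α) ∧
    -- (ii) the two problems have the same (finite, attained) value
    (∃ v : ℝ,
      IsGreatest {w : EReal | ∃ P : Θ → A → ℝ, FInfo.IsChoiceRule P ∧ w = FInfo.payoff f π P} v ∧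
      IsGreatest {w : EReal | ∃ α ∈ stdSimplex ℝ A, w = ⨅ l : Θ → ℝ, FInfo.dualObj f π α l} v) := by
  have hc := hreg.cofinite
  have hne : Nonempty A := hA.to_subtype
  refine ⟨⟨fun x => ?_, fun x => ?_⟩, fun P hP => ⟨fun hsol => ?_, ?_⟩, ?_, ?_⟩
  · rw [← FInfo.coe_toReal_conj hf hc]
    exact ⟨EReal.coe_ne_bot _, EReal.coe_ne_top _⟩
  · obtain ⟨y, hy⟩ := FInfo.exists_isConjMax hf hc x
    exact (hy.hasFDerivAt hf hc hreg.essStrictConvex).differentiableAt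
  · obtain ⟨α, hopt⟩ := hsol.exists_isJointOpt hf hc
    obtain ⟨l, hsaddle, heq⟩ := hopt.exists_isSaddle hf hreg
    exact ⟨α, l, hsaddle, hopt.eq_mul_gradConj hf hreg heq.le⟩
  · rintro ⟨α, l, hsaddle, hPα⟩
    exact (hsaddle.isJointOpt hf hreg hP hPα).isSolution hf hc
  · exact fun P hP α l hsaddle hPα => (hsaddle.isJointOpt hf hreg hP hPα).isFMean hf hc
  · obtain ⟨P, α, hopt⟩ := FInfo.exists_isJointOpt hf hc (FInfo.weighted π A)
    obtain ⟨l, hsaddle, heq⟩ := hopt.exists_isSaddle hf hreg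
    have hval : FInfo.dualObj f π α l = ((FInfo.gain (FInfo.weighted π A) P -
        (FInfo.divergence f P α).toReal : ℝ) : EReal) := by
      rw [FInfo.dualObj_eq hf hc, heq]
    refine ⟨FInfo.gain (FInfo.weighted π A) P - (FInfo.divergence f P α).toReal,
      ⟨⟨P, hopt.rule, (hopt.payoff_eq hf hc).symm⟩, ?_⟩, ⟨⟨α, hopt.mem, ?_⟩, ?_⟩⟩
    · rintro _ ⟨Q, hQ, rfl⟩
      exact hopt.payoff_le hf hc hQ
    · rw [← hval]
      exact le_antisymm (le_iInf hsaddle.2.2) (iInf_le _ l)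
    · rintro _ ⟨β, hβ, rfl⟩
      rw [← hval]
      -- The saddle multiplier `l` is one candidate in the inner infimum for every `β`.
      exact (iInf_le _ l).trans (hsaddle.2.1 β hβ)
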